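/- Consider the one-dimensional ghost hard-core process on $[0,L]$ with rods of length $2$. Candidate centres $x_1,x_2,\dots$ are independent and uniform on $[0,L]$, and the candidate rod at time $t$ is $R_t=(x_t-1,x_t+1)$. Start with $Y=\emptyset$. At each time $t=1,2,\dots$: if $[0,L]\setminus Y$ has no connected component of length at least $2$, the process stops; otherwise, the candidate rod is placed (accepted) if $x_t\in[1,L-1]$ and $R_t\cap Y=\emptyset$, and is rejected if not; in both cases $Y$ is replaced by $Y\cup(R_t\cap[0,L])$. Thus a placed rod overlaps neither an earlier placed rod nor an earlier rejected candidate. The infinite-time limit is the collection of all rods that are ever placed. A gap is a connected component $[a,b]$ of the part of $[0,L]$ that is not covered by the placed rods (the two gaps at the ends of the interval included), and its size is $b-a$. Then, as $L\to\infty$, the following hold in the infinite-time limit. 1. With probability tending to $1$, all gaps have size smaller than $\log L$. 2. For every $\varepsilon>0$, with probability tending to $1$, there is a gap between two adjacent placed rods that has size at least $(\log L)^{1-\varepsilon}$. -/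

import Mathlib

open MeasureTheory ProbabilityTheory Filter Topology Set

noncomputable section

namespace GhostHardCore

/-- The state of the ghost hard-core process on the interval `[0, L]`. -/
structure State where
  /-- The part `Y` of the interval that is covered by some earlier candidate rod,
  whether that rod was accepted or rejected. -/
  covered : Set ℝ
  /-- The centres of the accepted (placed) rods. -/
  rods : Set ℝ

/-- The rod of length `2` with centre `c`. -/
def rod (c : ℝ) : Set ℝ := Ioo (c - 1) (c + 1)

/-- The set `[0, L] ∖ Y` still has a connected component of length at least `2`,
that is, it contains an interval of length `2`. -/
def HasRoom (L : ℝ) (Y : Set ℝ) : Prop := ∃ a : ℝ, Icc a (a + 2) ⊆ Icc 0 L \ Y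

open Classical in
/-- One step of the process on `[0, L]`, with candidate centre `x`. If there is no room left then
the process has been aborted, and nothing changes any more. If the candidate rod sticks out of the
interval, or overlaps an earlier candidate rod, then it is rejected, but the part of the interval
that it covers is blocked. Otherwise it is accepted. -/
def step (L : ℝ) (S : State) (x : ℝ) : State :=
  if ¬ HasRoom L S.covered then S
  else if x ∉ Icc 1 (L - 1) then
    { covered := S.covered ∪ (rod x ∩ Icc 0 L), rods := S.rods }
  else if (rod x ∩ S.covered).Nonempty then
    { covered := S.covered ∪ rod x, rods := S.rods }
  else
    { covered := S.covered ∪ rod x, rods := insert x S.rods }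

/-- The state of the process on `[0, L]` after `t` steps, when the candidate centres are
`x 0, x 1, x 2, …`. -/
def run (L : ℝ) (x : ℕ → ℝ) : ℕ → State
  | 0 => { covered := ∅, rods := ∅ }
  | t + 1 => step L (run L x t) (x t)

/-- The centres of the rods placed in the infinite-time limit. -/
def limitRods (L : ℝ) (x : ℕ → ℝ) : Set ℝ := ⋃ t : ℕ, (run L x t).rods

/-- The part of `[0, L]` that is not occupied by a placed rod in the infinite-time limit. -/
def freeSpace (L : ℝ) (x : ℕ → ℝ) : Set ℝ := Icc 0 L \ ⋃ c ∈ limitRods L x, rod c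

/-- `[a, b]` is a gap of the infinite-time limit: it is a connected component of the part of
`[0, L]` that is not occupied by a placed rod. The two gaps at the ends of the interval count as
gaps too. (The free space is compact, so each of its components is a closed interval.) -/
def IsGap (L : ℝ) (x : ℕ → ℝ) (a b : ℝ) : Prop :=
  ∃ p ∈ freeSpace L x, connectedComponentIn (freeSpace L x) p = Icc a b

/-- The gap `[a, b]` lies between two adjacent placed rods, whose centres are `a - 1` and
`b + 1`. -/
def IsGapBetweenRods (L : ℝ) (x : ℕ → ℝ) (a b : ℝ) : Prop :=
  IsGap L x a b ∧ a - 1 ∈ limitRods L x ∧ b + 1 ∈ limitRods L x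

/-- The uniform distribution on `[0, L]`. -/
def uniform (L : ℝ) : Measure ℝ := cond volume (Icc 0 L)

/-- The law of the sequence of candidate centres: independent uniform points of `[0, L]`. -/
def candidateLaw (L : ℝ) : Measure (ℕ → ℝ) := Measure.infinitePi fun _ : ℕ => uniform L

theorem isProbabilityMeasure_uniform {L : ℝ} (hL : 0 < L) :
    IsProbabilityMeasure (uniform L) := by
  refine cond_isProbabilityMeasure_of_finite ?_ ?_
  · simpa using hL
  · simp

/-- For `L > 0` the law of the candidates is a genuine probability measure. -/
theorem isProbabilityMeasure_candidateLaw {L : ℝ} (hL : 0 < L) :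
    IsProbabilityMeasure (candidateLaw L) := by
  have := isProbabilityMeasure_uniform hL
  unfold candidateLaw
  infer_instance

/-- The event `E L` about the candidates on `[0, L]` holds with high probability as `L → ∞`: the
probability that it fails tends to `0`. -/
def WithHighProbability (E : ℝ → Set (ℕ → ℝ)) : Prop :=
  Tendsto (fun L : ℝ => candidateLaw L (E L)ᶜ) atTop (𝓝 0)

end GhostHardCore

end

/-! The stopping rule does not affect which rods are placed (`run_spec`, `mem_limitRods`): a rod is
placed exactly when its candidate fits and overlaps no earlier candidate. Both halves then rest on
conditioning on the first candidate (`iidLaw_head_tail`).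

Upper bound. A long gap contains an interval of length `4 * m` with integer left end in which no
candidate is ever placed. Shrink it repeatedly by `2` on each side. The first candidate in one of
these nested intervals would be placed if it fell into the next one, so it must fall into the outer
shell. The successive conditional probabilities are `1/m, 1/(m-1), …, 1`, with product `1/m!`
(`real_avoidsInner_zero_le`). There are at most `L` left ends, and `L / m!` tends to `0` for `m`
about `log L / 4`.

Lower bound. In a window of length `m + 7`, let the first `m + 2` candidates visit prescribed cells
of length `1/2` from left to right. The first and last are placed, each one between is rejected
because of its predecessor, and together they block all later rods in between
(`exists_isGapBetweenRods_of_hitsInOrder`). With `q = 2 * (m + 7)` this has probability `q ^ (-(m +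
2))`, and disjoint windows all fail with at most the probability that independence would give
(`real_forall_not_hitsInOrder_le`). For `m = ⌈(log L) ^ (1 - ε)⌉` one eventually has `q ^ (m + 3) ≤
√L`, so all windows fail with probability at most `exp (-√L)`. -/

noncomputable section

namespace GhostHardCore

/-! ### Sequences of independent identically distributed points -/

section IID

variable {α : Type*} [MeasurableSpace α] (μ : Measure α) [IsProbabilityMeasure μ]

/-- The sequence without its first entry. -/
def shift (x : ℕ → α) : ℕ → α := fun n => x (n + 1)

omit [MeasurableSpace α] in
@[simp] lemma shift_apply (x : ℕ → α) (n : ℕ) : shift x n = x (n + 1) := rfl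

lemma measurable_shift : Measurable (shift : (ℕ → α) → ℕ → α) := by
  unfold shift; fun_prop

/-- The law of an i.i.d. sequence. -/
abbrev iidLaw : Measure (ℕ → α) := Measure.infinitePi fun _ : ℕ => μ

/-- The sequence with first entry `p.1` followed by `p.2`. -/
def seqCons (p : α × (ℕ → α)) : ℕ → α
  | 0 => p.1
  | n + 1 => p.2 n

lemma measurable_seqCons : Measurable (seqCons : α × (ℕ → α) → ℕ → α) := by
  refine measurable_pi_iff.2 fun n => ?_
  cases n with
  | zero => exact measurable_fst
  | succ n => exact (measurable_pi_apply n).comp measurable_snd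

lemma map_seqCons : (μ.prod (iidLaw μ)).map seqCons = iidLaw μ := by
  classical
  refine Measure.eq_infinitePi _ fun s t ht => ?_
  obtain ⟨n, hn⟩ : ∃ n, s ⊆ Finset.range (n + 1) :=
    ⟨s.sup id, fun i hi => Finset.mem_range_succ_iff.2 (Finset.le_sup (f := id) hi)⟩
  -- Padding with `univ` makes the index set an initial segment of `ℕ`, from which the factor at `0`
  -- splits off.
  set t' : ℕ → Set α := fun i => if i ∈ s then t i else univ with ht'
  have hm : ∀ i, MeasurableSet (t' i) := fun i => by
    simp only [ht']; split_ifs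
    exacts [ht i, MeasurableSet.univ]
  have h1 : seqCons ⁻¹' (Set.pi s t) = t' 0 ×ˢ Set.pi (Finset.range n) (fun i => t' (i + 1)) := by
    ext ⟨a, x⟩
    simp only [mem_preimage, Set.mem_pi, mem_prod, Finset.mem_coe, Finset.mem_range, ht']
    constructor
    · intro h
      refine ⟨?_, fun i _ => ?_⟩
      · split_ifs with h0
        exacts [h 0 h0, trivial]
      · split_ifs with h0
        exacts [h (i + 1) h0, trivial]
    · rintro ⟨h0, h⟩ i hi
      cases i with
      | zero => simpa [hi, seqCons] using h0
      | succ i =>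
        have := h i (by have := Finset.mem_range.1 (hn hi); omega)
        simpa [hi, seqCons] using this
  rw [Measure.map_apply measurable_seqCons
    (MeasurableSet.pi s.countable_toSet fun i _ => ht i), h1, Measure.prod_prod,
    Measure.infinitePi_pi _ fun i _ => hm (i + 1), mul_comm,
    ← Finset.prod_range_succ' (fun i => μ (t' i)), ← Finset.prod_subset hn]
  · exact Finset.prod_congr rfl fun i hi => by simp [ht', hi]
  · intro i _ hi
    simp [ht', hi]

/-- The first entry of an i.i.d. sequence is independent of the remaining ones. -/
lemma iidLaw_head_tail {B : Set α} {V : Set (ℕ → α)} (hB : MeasurableSet B)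
    (hV : MeasurableSet V) :
    iidLaw μ {x | x 0 ∈ B ∧ shift x ∈ V} = μ B * iidLaw μ V := by
  conv_lhs => rw [← map_seqCons μ]
  have hm : MeasurableSet {x : ℕ → α | x 0 ∈ B ∧ shift x ∈ V} :=
    (measurable_pi_apply 0 hB).inter (measurable_shift hV)
  rw [Measure.map_apply measurable_seqCons hm, ← Measure.prod_prod]
  rfl

lemma iidLaw_real_head_tail {B : Set α} {V : Set (ℕ → α)} (hB : MeasurableSet B)
    (hV : MeasurableSet V) :
    (iidLaw μ).real {x | x 0 ∈ B ∧ shift x ∈ V} = μ.real B * (iidLaw μ).real V := by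
  simp [measureReal_def, iidLaw_head_tail μ hB hV]

/-- For every `j ∈ [i, m)`, the first entry of `x` in `J j`, if any, is not in `J (j + 1)`. -/
def AvoidsInner (J : ℕ → Set α) (m i : ℕ) : Set (ℕ → α) :=
  {x | ∀ j, i ≤ j → j < m → ∀ t, (∀ s < t, x s ∉ J j) → x t ∉ J (j + 1)}

lemma measurableSet_avoidsInner {J : ℕ → Set α} (hJ : ∀ i, MeasurableSet (J i)) (m i : ℕ) :
    MeasurableSet (AvoidsInner J m i) := by
  have h (n j : ℕ) : MeasurableSet {x : ℕ → α | x n ∈ J j} := measurable_pi_apply n (hJ j)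
  simp only [AvoidsInner, ofPred_forall]
  refine .iInter fun j => .iInter fun _ => .iInter fun _ => .iInter fun t => ?_
  have h2 : MeasurableSet {x : ℕ → α | ∀ s < t, x s ∉ J j} := by
    simp only [ofPred_forall]
    exact .iInter fun s => .iInter fun _ => (h _ _).compl
  convert h2.compl.union (h t (j + 1)).compl using 1
  ext x
  exact imp_iff_not_or

/-- Condition on the first entry: outside `J i` it changes nothing, in the shell `J i \ J (i + 1)`
it settles level `i` only, and in `J (i + 1)` it is forbidden. The probability of the event occurs
on both sides and is solved for. -/
lemma real_avoidsInner_le {J : ℕ → Set α} (hJ : ∀ i, MeasurableSet (J i)) (hJa : Antitone J)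
    {m i : ℕ} (hi : i < m) :
    μ.real (J i) * (iidLaw μ).real (AvoidsInner J m i) ≤
      μ.real (J i \ J (i + 1)) * (iidLaw μ).real (AvoidsInner J m (i + 1)) := by
  have hsub : AvoidsInner J m i ⊆
      {x | x 0 ∈ (J i)ᶜ ∧ shift x ∈ AvoidsInner J m i} ∪
      {x | x 0 ∈ J i \ J (i + 1) ∧ shift x ∈ AvoidsInner J m (i + 1)} := by
    intro x hx
    have key : ∀ k, i ≤ k → x 0 ∉ J k → shift x ∈ AvoidsInner J m k := by
      intro k hk h0 j hj hjm t ht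
      refine hx j (hk.trans hj) hjm (t + 1) fun s hs => ?_
      cases s with
      | zero => exact fun h => h0 (hJa hj h)
      | succ s => exact ht s (by omega)
    have h1 : x 0 ∉ J (i + 1) := hx i le_rfl hi 0 (by simp)
    by_cases h0 : x 0 ∈ J i
    · exact Or.inr ⟨⟨h0, h1⟩, key _ (by omega) h1⟩
    · exact Or.inl ⟨h0, key _ le_rfl h0⟩
  have h := (measureReal_mono (μ := iidLaw μ) hsub).trans (measureReal_union_le _ _)
  rw [iidLaw_real_head_tail μ (hJ i).compl (measurableSet_avoidsInner hJ m i),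
    iidLaw_real_head_tail μ ((hJ i).diff (hJ _)) (measurableSet_avoidsInner hJ m _),
    probReal_compl_eq_one_sub (hJ i)] at h
  linarith

/-- If `J 0 ⊇ J 1 ⊇ ⋯ ⊇ J m` where `J i` has measure `c * (m - i)`, then the probability that for
every `i < m` the first hit of `J i` misses `J (i + 1)` is at most `1 / m!`. -/
lemma real_avoidsInner_zero_le {J : ℕ → Set α} (hJ : ∀ i, MeasurableSet (J i)) (hJa : Antitone J)
    {m : ℕ} {c : ℝ} (hc : 0 < c) (hμ : ∀ i ≤ m, μ.real (J i) = c * (m - i)) :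
    (iidLaw μ).real (AvoidsInner J m 0) ≤ 1 / (m.factorial : ℝ) := by
  -- Induction from the innermost level outwards: with `k + 1` levels left, the shell takes up the
  -- proportion `1 / (k + 1)` of its interval.
  have main : ∀ k ≤ m, (iidLaw μ).real (AvoidsInner J m (m - k)) ≤ 1 / (k.factorial : ℝ) := by
    intro k
    induction k with
    | zero => exact fun _ => by simp
    | succ k ih =>
      intro hk
      have h := real_avoidsInner_le μ hJ hJa (m := m) (i := m - (k + 1)) (by omega)
      have e : m - (k + 1) + 1 = m - k := by omega
      rw [measureReal_sdiff (hJa (Nat.le_succ _)) (hJ _), hμ _ (by omega), hμ _ (by omega), Nat.succ_eq_add_one, e,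
        Nat.cast_sub hk, Nat.cast_sub (by omega : k ≤ m)] at h
      push_cast at h
      have h2 := ih (by omega)
      have h3 : (k + 1 : ℝ) * (iidLaw μ).real (AvoidsInner J m (m - (k + 1))) ≤
          1 / (k.factorial : ℝ) := by
        refine le_trans ?_ h2
        have h4 : c * ((k + 1 : ℝ) * (iidLaw μ).real (AvoidsInner J m (m - (k + 1)))) ≤
            c * (iidLaw μ).real (AvoidsInner J m (m - k)) := by nlinarith
        exact le_of_mul_le_mul_left h4 hc
      rw [Nat.factorial_succ, Nat.cast_mul, ← div_div, div_right_comm, le_div_iff₀ (by positivity)]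
      push_cast
      linarith
  simpa using main m le_rfl

/-- The successive entries of `x` in `J`, from the first one on, lie in the members of the list
of sets, in order. -/
def HitsInOrder (J : Set α) : List (Set α) → (ℕ → α) → Prop
  | [], _ => True
  | c :: cs, x => ∃ t, (∀ s < t, x s ∉ J) ∧ x t ∈ c ∧ HitsInOrder J cs fun n => x (t + 1 + n)

lemma measurableSet_hitsInOrder {J : Set α} (hJ : MeasurableSet J) :
    ∀ {l : List (Set α)}, (∀ c ∈ l, MeasurableSet c) → MeasurableSet {x | HitsInOrder J l x}
  | [], _ => by simp [HitsInOrder]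
  | c :: cs, h => by
    have ih := measurableSet_hitsInOrder hJ (l := cs) fun d hd => h d (by simp [hd])
    have hf (t : ℕ) : Measurable fun (x : ℕ → α) n => x (t + 1 + n) := by fun_prop
    simp only [HitsInOrder, ofPred_exists, ofPred_and, ofPred_forall]
    refine .iUnion fun t => .inter (.iInter fun s => .iInter fun _ => ?_) (.inter ?_ (hf t ih))
    · exact (measurable_pi_apply s hJ).compl
    · exact measurable_pi_apply t (h c (by simp))

omit [MeasurableSpace α] in
lemma hitsInOrder_of_shift_of_notMem {J c : Set α} {cs : List (Set α)} {x : ℕ → α}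
    (h0 : x 0 ∉ J) (h : HitsInOrder J (c :: cs) (shift x)) : HitsInOrder J (c :: cs) x := by
  obtain ⟨t, h1, h2, h3⟩ := h
  refine ⟨t + 1, fun s hs => ?_, h2, ?_⟩
  · cases s with
    | zero => exact h0
    | succ s => exact h1 s (by omega)
  · convert h3 using 2 with n
    simp only [shift_apply]
    congr 1
    omega

omit [MeasurableSpace α] in
lemma hitsInOrder_of_shift_of_mem {J c : Set α} {cs : List (Set α)} {x : ℕ → α}
    (h0 : x 0 ∈ c) (h : HitsInOrder J cs (shift x)) : HitsInOrder J (c :: cs) x := by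
  refine ⟨0, by simp, h0, ?_⟩
  convert h using 2 with n
  simp only [shift_apply]
  congr 1
  omega

omit [MeasurableSpace α] in
-- Unfolds the recursion into visiting times; the last clause says that these are the only visits to
-- `J` up to then.
lemma HitsInOrder.exists_times {J : Set α} : ∀ {l : List (Set α)} {x : ℕ → α},
    HitsInOrder J l x → ∃ τ : ℕ → ℕ, StrictMono τ ∧ (∀ k (hk : k < l.length), x (τ k) ∈ l[k]) ∧
      ∀ k < l.length, ∀ t ≤ τ k, x t ∈ J → ∃ j ≤ k, t = τ j
  | [], _, _ => ⟨id, strictMono_id, by simp, by simp⟩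
  | c :: cs, x, h => by
    obtain ⟨t, h1, h2, h3⟩ := h
    obtain ⟨τ, hmono, hmem, hex⟩ := h3.exists_times
    refine ⟨fun | 0 => t | k + 1 => t + 1 + τ k, strictMono_nat_of_lt_succ fun n => ?_, ?_, ?_⟩
    · cases n with
      | zero => simp only; omega
      | succ n => have := hmono (Nat.lt_add_one n); simp only; omega
    · intro k hk
      cases k with
      | zero => exact h2
      | succ k => exact hmem k (by simpa using hk)
    · intro k hk s hs hxs
      have hts : t ≤ s := by
        by_contra hlt
        exact h1 s (by omega) hxs
      rcases hts.eq_or_lt with rfl | hts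
      · exact ⟨0, by omega, rfl⟩
      · cases k with
        | zero => simp only at hs; omega
        | succ k =>
          simp only at hs
          obtain ⟨j, hj, hjs⟩ := hex k (by simpa using hk) (s - (t + 1)) (by omega)
            (by rwa [show t + 1 + (s - (t + 1)) = s by omega])
          exact ⟨j + 1, by omega, by simp only; omega⟩

/-- Let the sets `J i` be disjoint, and let the members of the list `l i` be subsets of `J i` that
take up the proportion `p` of it. An i.i.d. sequence fails to visit in order the members of all of
these lists with at most the probability that independence of the windows `J i` predicts. -/
lemma real_forall_not_hitsInOrder_le {ι : Type*} [DecidableEq ι] {J : ι → Set α}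
    (hJ : ∀ i, MeasurableSet (J i)) (hd : Pairwise (Function.onFun Disjoint J)) {p : ℝ}
    (hp0 : 0 ≤ p) (hp1 : p ≤ 1) (S : Finset ι) (l : ι → List (Set α))
    (hpos : ∀ i ∈ S, 0 < μ.real (J i))
    (hl : ∀ i ∈ S, ∀ c ∈ l i, MeasurableSet c ∧ c ⊆ J i ∧ μ.real c = p * μ.real (J i)) :
    (iidLaw μ).real {x | ∀ i ∈ S, ¬ HitsInOrder (J i) (l i) x} ≤
      ∏ i ∈ S, (1 - p ^ (l i).length) := by
  induction hn : ∑ i ∈ S, ((l i).length + 1) using Nat.strong_induction_on generalizing S l with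
  | _ n ih =>
  have hfac : ∀ k : ℕ, 0 ≤ 1 - p ^ k := fun k => sub_nonneg.2 (pow_le_one₀ hp0 hp1)
  rcases S.eq_empty_or_nonempty with rfl | hS
  · simp
  by_cases hnil : ∃ i ∈ S, l i = []
  · obtain ⟨i, hi, hli⟩ := hnil
    have : {x | ∀ i ∈ S, ¬ HitsInOrder (J i) (l i) x} = ∅ := by
      refine eq_empty_of_forall_notMem fun x hx => hx i hi ?_
      rw [hli]; trivial
    rw [this, measureReal_empty]
    exact Finset.prod_nonneg fun i _ => hfac _
  push Not at hnil
  have hcons : ∀ i, ∃ c cs, i ∈ S → l i = c :: cs := fun i => by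
    by_cases hi : i ∈ S
    · obtain ⟨c, cs, h⟩ := List.exists_cons_of_ne_nil (hnil i hi)
      exact ⟨c, cs, fun _ => h⟩
    · exact ⟨∅, [], fun h => absurd h hi⟩
  choose c cs hc using hcons
  set N : Finset ι → (ι → List (Set α)) → Set (ℕ → α) :=
    fun S l => {x | ∀ i ∈ S, ¬ HitsInOrder (J i) (l i) x} with hN
  have hNm : ∀ S l, (∀ i ∈ S, ∀ c ∈ l i, MeasurableSet c) → MeasurableSet (N S l) := by
    intro S l h
    simp only [hN, ofPred_forall]
    exact S.measurableSet_biInter fun i hi => (measurableSet_hitsInOrder (hJ i) (h i hi)).compl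
  have hhead : ∀ i ∈ S, MeasurableSet (c i) ∧ c i ⊆ J i ∧ μ.real (c i) = p * μ.real (J i) :=
    fun i hi => hl i hi (c i) (by simp [hc i hi])
  have hupd : ∀ i ∈ S, ∀ k ∈ S, ∀ d ∈ Function.update l i (cs i) k, d ∈ l k := by
    intro i hi k hk d hd
    by_cases h : k = i
    · subst h
      rw [Function.update_self] at hd
      simp [hc k hi, hd]
    · rwa [Function.update_of_ne h] at hd
  set U : Set α := ⋃ i ∈ S, J i with hU
  have hUm : MeasurableSet U := S.measurableSet_biUnion fun i _ => hJ i
  -- The first entry either misses all windows, or hits the required cell of window `i` and shortens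
  -- its list, or spoils window `i`, which is then dropped.
  have hsub : N S l ⊆ {x | x 0 ∈ Uᶜ ∧ shift x ∈ N S l} ∪
      ⋃ i ∈ S, ({x | x 0 ∈ c i ∧ shift x ∈ N S (Function.update l i (cs i))} ∪
        {x | x 0 ∈ J i \ c i ∧ shift x ∈ N (S.erase i) l}) := by
    intro x hx
    have key : ∀ k ∈ S, x 0 ∉ J k → ¬ HitsInOrder (J k) (l k) (shift x) := by
      intro k hk h0 h
      refine hx k hk ?_
      rw [hc k hk] at h ⊢
      exact hitsInOrder_of_shift_of_notMem h0 h
    by_cases h0 : x 0 ∈ U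
    · right
      simp only [hU, mem_iUnion, exists_prop] at h0
      obtain ⟨i, hi, hxi⟩ := h0
      have hne : ∀ k, k ≠ i → x 0 ∉ J k := fun k hk h => (hd hk).le_bot ⟨h, hxi⟩
      refine mem_iUnion₂.2 ⟨i, hi, ?_⟩
      by_cases hxc : x 0 ∈ c i
      · refine Or.inl ⟨hxc, fun k hk => ?_⟩
        by_cases hki : k = i
        · subst hki
          rw [Function.update_self]
          intro h
          refine hx k hk ?_
          rw [hc k hk]
          exact hitsInOrder_of_shift_of_mem hxc h
        · rw [Function.update_of_ne hki]
          exact key k hk (hne k hki)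
      · exact Or.inr ⟨⟨hxi, hxc⟩, fun k hk =>
          key k (Finset.mem_of_mem_erase hk) (hne k (Finset.ne_of_mem_erase hk))⟩
    · refine Or.inl ⟨h0, fun k hk => key k hk fun h => h0 ?_⟩
      exact mem_iUnion₂.2 ⟨k, hk, h⟩
  have hUμ : μ.real U = ∑ i ∈ S, μ.real (J i) :=
    measureReal_biUnion_finset (fun i _ j _ hij => hd hij) fun i _ => hJ i
  have hpos' : 0 < ∑ i ∈ S, μ.real (J i) := Finset.sum_pos hpos hS
  set P : ℝ := ∏ i ∈ S, (1 - p ^ (l i).length) with hP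
  have hterm : ∀ i ∈ S,
      (iidLaw μ).real ({x | x 0 ∈ c i ∧ shift x ∈ N S (Function.update l i (cs i))} ∪
        {x | x 0 ∈ J i \ c i ∧ shift x ∈ N (S.erase i) l}) ≤ μ.real (J i) * P := by
    intro i hi
    obtain ⟨hm, hsubJ, hμ⟩ := hhead i hi
    refine (measureReal_union_le _ _).trans ?_
    rw [iidLaw_real_head_tail μ hm
        (hNm _ _ fun k hk d hd => (hl k hk d (hupd i hi k hk d hd)).1),
      iidLaw_real_head_tail μ ((hJ i).diff hm)
        (hNm _ _ fun k hk d hd => (hl k (Finset.mem_of_mem_erase hk) d hd).1),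
      measureReal_sdiff hsubJ hm, hμ]
    have hlen : (l i).length = (cs i).length + 1 := by rw [hc i hi, List.length_cons]
    have h1 := ih (∑ k ∈ S, ((Function.update l i (cs i) k).length + 1)) (by
        rw [← hn]
        refine Finset.sum_lt_sum (fun k hk => ?_) ⟨i, hi, by simp [hlen]⟩
        by_cases h : k = i
        · subst h; simp [hlen]
        · simp [Function.update_of_ne h]) S (Function.update l i (cs i)) hpos
      (fun k hk d hd => hl k hk d (hupd i hi k hk d hd)) rfl
    have h2 := ih (∑ k ∈ S.erase i, ((l k).length + 1)) (by
        rw [← hn, ← Finset.add_sum_erase S _ hi]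
        omega) (S.erase i) l (fun k hk => hpos k (Finset.mem_of_mem_erase hk))
      (fun k hk => hl k (Finset.mem_of_mem_erase hk)) rfl
    set Q : ℝ := ∏ k ∈ S.erase i, (1 - p ^ (l k).length) with hQ
    have hPQ : P = (1 - p ^ ((cs i).length + 1)) * Q := by
      rw [hP, ← Finset.mul_prod_erase S _ hi, hlen]
    have h1' : ∏ k ∈ S, (1 - p ^ (Function.update l i (cs i) k).length) =
        (1 - p ^ (cs i).length) * Q := by
      rw [← Finset.mul_prod_erase S _ hi, Function.update_self]
      congr 1
      exact Finset.prod_congr rfl fun k hk => by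
        rw [Function.update_of_ne (Finset.ne_of_mem_erase hk)]
    rw [h1'] at h1
    have hJpos := hpos i hi
    -- The product form is preserved because `p * (1 - p ^ k) + (1 - p) = 1 - p ^ (k + 1)`.
    calc p * μ.real (J i) * (iidLaw μ).real (N S (Function.update l i (cs i))) +
          (μ.real (J i) - p * μ.real (J i)) * (iidLaw μ).real (N (S.erase i) l)
        ≤ p * μ.real (J i) * ((1 - p ^ (cs i).length) * Q) +
          (μ.real (J i) - p * μ.real (J i)) * Q := by
          have : 0 ≤ μ.real (J i) - p * μ.real (J i) := by nlinarith
          gcongr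
      _ = μ.real (J i) * P := by rw [hPQ]; ring
  have h := (measureReal_mono (μ := iidLaw μ) hsub).trans ((measureReal_union_le _ _).trans
    (add_le_add le_rfl ((measureReal_biUnion_finset_le S _).trans (Finset.sum_le_sum hterm))))
  rw [iidLaw_real_head_tail μ hUm.compl (hNm S l fun i hi d hd => (hl i hi d hd).1),
    probReal_compl_eq_one_sub hUm, hUμ, ← Finset.sum_mul] at h
  have h3 : (∑ i ∈ S, μ.real (J i)) * (iidLaw μ).real (N S l) ≤
      (∑ i ∈ S, μ.real (J i)) * P := by linarith
  exact le_of_mul_le_mul_left h3 hpos'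

end IID

/-! ### The placed rods -/

/-- The candidate at time `t` fits into `[0, L]` and overlaps no earlier candidate. -/
def IsPlaced (L : ℝ) (x : ℕ → ℝ) (t : ℕ) : Prop :=
  x t ∈ Icc 1 (L - 1) ∧ ∀ s < t, 2 ≤ |x t - x s|

/-- The part of `[0, L]` that is covered by the candidates before time `t`. -/
def candidateCover (L : ℝ) (x : ℕ → ℝ) (t : ℕ) : Set ℝ := ⋃ s < t, rod (x s) ∩ Icc 0 L

lemma candidateCover_succ (L : ℝ) (x : ℕ → ℝ) (t : ℕ) :
    candidateCover L x (t + 1) = candidateCover L x t ∪ (rod (x t) ∩ Icc 0 L) := by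
  ext y
  simp only [candidateCover, mem_iUnion, mem_union, exists_prop, Nat.lt_succ_iff_lt_or_eq]
  constructor
  · rintro ⟨s, hs | rfl, h⟩
    exacts [Or.inl ⟨s, hs, h⟩, Or.inr h]
  · rintro (⟨s, hs, h⟩ | h)
    exacts [⟨s, Or.inl hs, h⟩, ⟨t, Or.inr rfl, h⟩]

lemma mem_rod {c y : ℝ} : y ∈ rod c ↔ |y - c| < 1 := by
  rw [rod, mem_Ioo, abs_lt]
  constructor <;> rintro ⟨h1, h2⟩ <;> constructor <;> linarith

lemma rod_subset_Icc {L c : ℝ} (h : c ∈ Icc 1 (L - 1)) : rod c ⊆ Icc 0 L := fun y hy =>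
  ⟨by linarith [hy.1, h.1], by linarith [hy.2, h.2]⟩

lemma rod_inter_rod_nonempty {c d : ℝ} (h : |c - d| < 2) : (rod c ∩ rod d).Nonempty := by
  rw [abs_lt] at h
  refine ⟨(c + d) / 2, ⟨?_, ?_⟩, ?_, ?_⟩ <;> linarith

lemma rod_inter_candidateCover_nonempty_iff {L c : ℝ} {x : ℕ → ℝ} {t : ℕ}
    (hc : c ∈ Icc 1 (L - 1)) :
    (rod c ∩ candidateCover L x t).Nonempty ↔ ∃ s < t, |c - x s| < 2 := by
  simp only [candidateCover]
  constructor
  · rintro ⟨y, hy, hy'⟩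
    simp only [mem_iUnion, exists_prop] at hy'
    obtain ⟨s, hs, hys, -⟩ := hy'
    refine ⟨s, hs, ?_⟩
    rw [mem_rod] at hy hys
    rw [abs_lt] at *
    constructor <;> linarith
  · rintro ⟨s, hs, h⟩
    obtain ⟨y, hy, hys⟩ := rod_inter_rod_nonempty h
    exact ⟨y, hy, mem_iUnion₂.2 ⟨s, hs, hys, rod_subset_Icc hc hy⟩⟩

/-- The closed rod itself is the free interval of length `2`; its endpoints are free since earlier
rods are open. -/
lemma hasRoom_of_isPlaced {L : ℝ} {x : ℕ → ℝ} {t : ℕ} (h : IsPlaced L x t) :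
    HasRoom L (candidateCover L x t) := by
  obtain ⟨⟨h1, h2⟩, h3⟩ := h
  refine ⟨x t - 1, fun y hy => ⟨⟨by linarith [hy.1], by linarith [hy.2]⟩, fun hy' => ?_⟩⟩
  simp only [candidateCover, mem_iUnion, exists_prop] at hy'
  obtain ⟨s, hs, hys, -⟩ := hy'
  have h4 := h3 s hs
  rcases le_abs.1 h4 with h4 | h4
  · linarith [hys.2, hy.1]
  · linarith [hys.1, hy.2]

lemma HasRoom.anti {L : ℝ} {Y Z : Set ℝ} (h : HasRoom L Z) (hYZ : Y ⊆ Z) : HasRoom L Y := by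
  obtain ⟨a, ha⟩ := h
  exact ⟨a, ha.trans (sdiff_subset_sdiff_right hYZ)⟩

/-- Until the process is aborted, the covered part is covered by the candidates so far; aborting
the process does not affect the placed rods. -/
lemma run_spec (L : ℝ) (x : ℕ → ℝ) (t : ℕ) :
    (run L x t).covered ⊆ candidateCover L x t ∧
    (HasRoom L (run L x t).covered → (run L x t).covered = candidateCover L x t) ∧
    (run L x t).rods = {c | ∃ s < t, IsPlaced L x s ∧ x s = c} := by
  induction t with
  | zero => simp [run, candidateCover]
  | succ t ih =>
    obtain ⟨hsub, heq, hrods⟩ := ih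
    have hsplit : {c | ∃ s < t + 1, IsPlaced L x s ∧ x s = c} =
        {c | ∃ s < t, IsPlaced L x s ∧ x s = c} ∪ {c | IsPlaced L x t ∧ x t = c} := by
      ext c
      constructor
      · rintro ⟨s, hs, h⟩
        rcases Nat.lt_succ_iff_lt_or_eq.1 hs with hs | rfl
        exacts [Or.inl ⟨s, hs, h⟩, Or.inr h]
      · rintro (⟨s, hs, h⟩ | h)
        exacts [⟨s, hs.trans (Nat.lt_succ_self t), h⟩, ⟨t, Nat.lt_succ_self t, h⟩]
    rw [hsplit, candidateCover_succ, run, step]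
    by_cases hroom : HasRoom L (run L x t).covered
    · have hcov := heq hroom
      rw [if_neg (not_not.2 hroom), hcov, hrods]
      by_cases hfit : x t ∈ Icc 1 (L - 1)
      · rw [if_neg (not_not.2 hfit), inter_eq_left.2 (rod_subset_Icc hfit)]
        by_cases hov : (rod (x t) ∩ candidateCover L x t).Nonempty
        · rw [if_pos hov]
          refine ⟨Subset.rfl, fun _ => rfl, ?_⟩
          obtain ⟨s, hs, h⟩ := (rod_inter_candidateCover_nonempty_iff hfit).1 hov
          have : ¬ IsPlaced L x t := fun hp => absurd (hp.2 s hs) (not_le.2 h)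
          simp [this]
        · rw [if_neg hov]
          refine ⟨Subset.rfl, fun _ => rfl, ?_⟩
          have : IsPlaced L x t := by
            refine ⟨hfit, fun s hs => ?_⟩
            by_contra! h
            exact hov ((rod_inter_candidateCover_nonempty_iff hfit).2 ⟨s, hs, h⟩)
          ext c
          simp only [mem_insert_iff, mem_union, mem_ofPred_eq, this, true_and]
          rw [or_comm, eq_comm]
      · rw [if_pos hfit]
        refine ⟨Subset.rfl, fun _ => rfl, ?_⟩
        have : ¬ IsPlaced L x t := fun hp => hfit hp.1
        simp [this]
    · rw [if_pos hroom]
      refine ⟨hsub.trans subset_union_left, fun h => absurd h hroom, ?_⟩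
      -- After stopping, `covered` is frozen inside the growing candidate cover, so room in the
      -- latter would be room in the former.
      have : ¬ IsPlaced L x t := fun hp => hroom ((hasRoom_of_isPlaced hp).anti hsub)
      simp [hrods, this]

lemma mem_limitRods {L c : ℝ} {x : ℕ → ℝ} :
    c ∈ limitRods L x ↔ ∃ t, IsPlaced L x t ∧ x t = c := by
  simp only [limitRods, mem_iUnion, (run_spec L x _).2.2]
  constructor
  · rintro ⟨_, s, -, h⟩
    exact ⟨s, h⟩
  · rintro ⟨s, h⟩
    exact ⟨s + 1, s, Nat.lt_succ_self s, h⟩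

lemma mem_freeSpace {L y : ℝ} {x : ℕ → ℝ} :
    y ∈ freeSpace L x ↔ y ∈ Icc 0 L ∧ ∀ c ∈ limitRods L x, 1 ≤ |y - c| := by
  simp [freeSpace, mem_rod]

lemma IsGap.subset_freeSpace {L a b : ℝ} {x : ℕ → ℝ} (h : IsGap L x a b) :
    Icc a b ⊆ freeSpace L x := by
  obtain ⟨p, -, hp⟩ := h
  rw [← hp]
  exact connectedComponentIn_subset _ _

/-- Well inside a gap, no candidate is placed. -/
lemma IsGap.not_isPlaced {L a b : ℝ} {x : ℕ → ℝ} (h : IsGap L x a b) {t : ℕ}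
    (ht : x t ∈ Icc a b) : ¬ IsPlaced L x t := fun hp => by
  have := (mem_freeSpace.1 (h.subset_freeSpace ht)).2 _ (mem_limitRods.2 ⟨t, hp, rfl⟩)
  norm_num at this

/-- If no candidate of an interval is ever placed, then the first candidate in it lies within
distance `2` of its boundary, and the same holds for all shorter concentric intervals. -/
lemma mem_avoidsInner_of_not_isPlaced {L u : ℝ} {x : ℕ → ℝ} {m : ℕ} (hu : 1 ≤ u)
    (hL : u + 4 * m ≤ L - 1) (h : ∀ t, x t ∈ Icc u (u + 4 * m) → ¬ IsPlaced L x t) :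
    x ∈ AvoidsInner (fun i : ℕ => Icc (u + 2 * i) (u + 4 * m - 2 * i)) m 0 := by
  intro j _ _ t ht hmem
  simp only [mem_Icc] at hmem
  push_cast at hmem
  have hj : (0 : ℝ) ≤ j := Nat.cast_nonneg j
  have hn := h t ⟨by linarith [hmem.1], by linarith [hmem.2]⟩
  refine hn ⟨⟨by linarith [hmem.1], by linarith [hmem.2]⟩, fun s hs => ?_⟩
  by_contra! hlt
  rw [abs_lt] at hlt
  exact ht s hs ⟨by linarith [hmem.1], by linarith [hmem.2]⟩

/-- Two placed rods with no placed rod in between are the boundary of a gap. -/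
lemma isGapBetweenRods_of_forall_notMem {L c d : ℝ} {x : ℕ → ℝ} (hc : c ∈ limitRods L x)
    (hd : d ∈ limitRods L x) (hcd : c + 2 ≤ d) (h : ∀ y ∈ Ioo c d, y ∉ limitRods L x) :
    IsGapBetweenRods L x (c + 1) (d - 1) := by
  have hfit : ∀ {e}, e ∈ limitRods L x → e ∈ Icc 1 (L - 1) := fun he => by
    obtain ⟨t, ht, rfl⟩ := mem_limitRods.1 he
    exact ht.1
  have hsub : Icc (c + 1) (d - 1) ⊆ freeSpace L x := by
    intro y hy
    refine mem_freeSpace.2 ⟨⟨by linarith [(hfit hc).1, hy.1], by linarith [(hfit hd).2, hy.2]⟩,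
      fun e he => ?_⟩
    have : e ≤ c ∨ d ≤ e := by
      by_contra! hcon
      exact h e hcon he
    rcases this with he | he
    · exact le_abs.2 (Or.inl (by linarith [hy.1]))
    · exact le_abs.2 (Or.inr (by linarith [hy.2]))
  have hmem : c + 1 ∈ Icc (c + 1) (d - 1) := ⟨le_rfl, by linarith⟩
  refine ⟨⟨c + 1, hsub hmem, Subset.antisymm ?_ ?_⟩, by simpa using hc, by simpa using hd⟩
  · intro z hz
    have hord : (connectedComponentIn (freeSpace L x) (c + 1)).OrdConnected :=
      isPreconnected_connectedComponentIn.ordConnected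
    have hbase : c + 1 ∈ connectedComponentIn (freeSpace L x) (c + 1) :=
      mem_connectedComponentIn (hsub hmem)
    -- The component is order-connected, so a point beyond either end would drag a point of a
    -- bounding rod into the free space.
    have havoid : ∀ e ∈ limitRods L x, ∀ y ∈ uIcc z (c + 1), 1 ≤ |y - e| := fun e he y hy =>
      (mem_freeSpace.1 (connectedComponentIn_subset _ _ (hord.uIcc_subset hz hbase hy))).2 e he
    constructor
    · by_contra! hlt
      have := havoid c hc (max z c) (by
        rw [uIcc_of_le hlt.le]
        exact ⟨le_max_left _ _, max_le hlt.le (by linarith)⟩)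
      have h2 : |max z c - c| < 1 := by
        rw [abs_of_nonneg (sub_nonneg.2 (le_max_right _ _))]
        rcases max_cases z c with ⟨h, _⟩ | ⟨h, _⟩ <;> rw [h] <;> linarith
      linarith
    · by_contra! hlt
      have := havoid d hd (min z d) (by
        rw [uIcc_of_ge (by linarith)]
        exact ⟨le_min (by linarith) (by linarith), min_le_left _ _⟩)
      have h2 : |min z d - d| < 1 := by
        rw [abs_of_nonpos (sub_nonpos.2 (min_le_right _ _))]
        rcases min_cases z d with ⟨h, _⟩ | ⟨h, _⟩ <;> rw [h] <;> linarith
      linarith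
  · exact isPreconnected_Icc.subset_connectedComponentIn hmem hsub

/-- The cells, in the window `[w, w + m + 7)`, of a first rod, of `m` overlapping candidates to the
right of it and of a last rod. -/
def cells (w : ℝ) (m : ℕ) : List (Set ℝ) :=
  (List.range (m + 1)).map (fun k : ℕ => Icc (w + 2 + k) (w + 2 + k + 1 / 2)) ++
    [Icc (w + m + 9 / 2) (w + m + 5)]

@[simp] lemma length_cells (w : ℝ) (m : ℕ) : (cells w m).length = m + 2 := by simp [cells]

lemma cells_getElem_of_le {w : ℝ} {m k : ℕ} (hk : k ≤ m) (h : k < (cells w m).length) :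
    (cells w m)[k] = Icc (w + 2 + k) (w + 2 + k + 1 / 2) := by
  simp only [cells]
  rw [List.getElem_append_left (by simpa using Nat.lt_succ_of_le hk)]
  simp

lemma cells_getElem_last {w : ℝ} {m : ℕ} (h : m + 1 < (cells w m).length) :
    (cells w m)[m + 1] = Icc (w + m + 9 / 2) (w + m + 5) := by
  simp [cells]

/-- If the first candidates in a window visit the cells in order, then the first and the last of
them are placed, and no rod is ever placed in between. -/
lemma exists_isGapBetweenRods_of_hitsInOrder {L w : ℝ} {m : ℕ} {x : ℕ → ℝ} (hw : 0 ≤ w)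
    (hL : w + m + 7 ≤ L) (h : HitsInOrder (Ico w (w + m + 7)) (cells w m) x) :
    ∃ a b, IsGapBetweenRods L x a b ∧ (m : ℝ) ≤ b - a := by
  obtain ⟨τ, hmono, hmem, hex⟩ := h.exists_times
  have hm0 : (0 : ℝ) ≤ m := Nat.cast_nonneg m
  have hcell : ∀ k ≤ m, x (τ k) ∈ Icc (w + 2 + k) (w + 2 + k + 1 / 2) := fun k hk => by
    have h := hmem k (by simp; omega)
    rwa [cells_getElem_of_le hk] at h
  have hlast : x (τ (m + 1)) ∈ Icc (w + m + 9 / 2) (w + m + 5) := by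
    have h := hmem (m + 1) (by simp)
    rwa [cells_getElem_last] at h
  have hfirst := hcell 0 (Nat.zero_le m)
  simp only [Nat.cast_zero, add_zero] at hfirst
  -- Margins of `2` at both ends of the window keep every candidate that could overlap the first or
  -- last rod inside the window.
  have hp0 : IsPlaced L x (τ 0) := by
    refine ⟨⟨by linarith [hfirst.1], by linarith [hfirst.2]⟩, fun s hs => ?_⟩
    by_contra! hlt
    rw [abs_lt] at hlt
    obtain ⟨j, hj, rfl⟩ := hex 0 (by simp) s hs.le
      ⟨by linarith [hfirst.1], by linarith [hfirst.2]⟩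
    have : j = 0 := by omega
    subst this
    exact lt_irrefl _ hs
  have hp1 : IsPlaced L x (τ (m + 1)) := by
    refine ⟨⟨by linarith [hlast.1], by linarith [hlast.2]⟩, fun s hs => ?_⟩
    by_contra! hlt
    rw [abs_lt] at hlt
    obtain ⟨j, hj, rfl⟩ := hex (m + 1) (by simp) s hs.le
      ⟨by linarith [hlast.1], by linarith [hlast.2]⟩
    have hjm : j ≤ m := by
      have := hmono.lt_iff_lt.1 hs
      omega
    have hjm' : (j : ℝ) ≤ m := Nat.cast_le.2 hjm
    -- The last cell starts exactly `2` after the end of cell `m`.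
    linarith [(hcell j hjm).2, hlast.1]
  refine ⟨x (τ 0) + 1, x (τ (m + 1)) - 1, isGapBetweenRods_of_forall_notMem
    (mem_limitRods.2 ⟨_, hp0, rfl⟩) (mem_limitRods.2 ⟨_, hp1, rfl⟩)
    (by linarith [hfirst.2, hlast.1]) ?_, by linarith [hfirst.2, hlast.1]⟩
  rintro y ⟨hy0, hy1⟩ hy
  obtain ⟨t, ht, rfl⟩ := mem_limitRods.1 hy
  have hfar : ∀ j, τ j < t → 2 ≤ |x t - x (τ j)| := fun j hj => ht.2 _ hj
  rcases le_or_gt t (τ (m + 1)) with hle | hgt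
  · obtain ⟨j, hj, rfl⟩ := hex (m + 1) (by simp) t hle
      ⟨by linarith [hfirst.1], by linarith [hlast.2]⟩
    rcases Nat.eq_zero_or_pos j with rfl | hj0
    · exact lt_irrefl _ hy0
    rcases hj.eq_or_lt with rfl | hjm
    · exact lt_irrefl _ hy1
    obtain ⟨i, rfl⟩ : ∃ i, j = i + 1 := ⟨j - 1, by omega⟩
    have h1 := hcell i (by omega)
    have h2 := hcell (i + 1) (by omega)
    push_cast at h2
    have h3 := hfar i (hmono (Nat.lt_succ_self i))
    -- Points of consecutive cells are at most `3/2` apart.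
    rcases le_abs.1 h3 with h3 | h3 <;> linarith [h1.1, h1.2, h2.1, h2.2]
  · have hall : ∀ j ≤ m + 1, 2 ≤ |x t - x (τ j)| := fun j hj =>
      hfar j ((hmono.monotone hj).trans_lt hgt)
    -- A later rod between the two ends would be pushed to the right past each candidate in turn,
    -- and finally would need distance `4` between the last two, which are at most `3` apart.
    have hind : ∀ j ≤ m, x (τ j) + 2 ≤ x t := by
      intro j
      induction j with
      | zero =>
        intro _
        rcases le_abs.1 (hall 0 (by omega)) with h3 | h3 <;> linarith
      | succ j ih =>
        intro hj
        have h1 := hcell j (by omega)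
        have h2 := hcell (j + 1) hj
        push_cast at h2
        have h4 := ih (by omega)
        rcases le_abs.1 (hall (j + 1) (by omega)) with h3 | h3 <;>
          linarith [h1.1, h1.2, h2.1, h2.2]
    have h1 := hind m le_rfl
    have h2 := hcell m le_rfl
    rcases le_abs.1 (hall (m + 1) le_rfl) with h3 | h3 <;>
      linarith [h2.1, h2.2, hlast.1, hlast.2]

/-! ### Large gaps are unlikely -/

lemma uniform_real {L : ℝ} (hL : 0 < L) {A : Set ℝ} (hA : A ⊆ Icc 0 L) :
    (uniform L).real A = volume.real A / L := by
  rw [uniform, measureReal_def, cond_apply measurableSet_Icc, inter_eq_right.2 hA,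
    ENNReal.toReal_mul, ENNReal.toReal_inv, ← measureReal_def, ← measureReal_def,
    Real.volume_real_Icc_of_le hL.le, sub_zero, div_eq_inv_mul]

lemma uniform_real_Icc {L a b : ℝ} (hL : 0 < L) (ha : 0 ≤ a) (hab : a ≤ b) (hb : b ≤ L) :
    (uniform L).real (Icc a b) = (b - a) / L := by
  rw [uniform_real hL (Icc_subset_Icc ha hb), Real.volume_real_Icc_of_le hab]

lemma uniform_real_Ico {L a b : ℝ} (hL : 0 < L) (ha : 0 ≤ a) (hab : a ≤ b) (hb : b ≤ L) :
    (uniform L).real (Ico a b) = (b - a) / L := by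
  rw [uniform_real hL (Ico_subset_Icc_self.trans (Icc_subset_Icc ha hb)),
    Real.volume_real_Ico_of_le hab]

/-- The probability that some gap has size at least `4 * m + 3` is at most `L / m!`. -/
lemma candidateLaw_real_exists_gap_le {L g : ℝ} (hL : 0 < L) {m : ℕ} (hm : 4 * (m : ℝ) + 3 ≤ g) :
    (candidateLaw L).real {x | ∀ a b, IsGap L x a b → b - a < g}ᶜ ≤ L / (m.factorial : ℝ) := by
  have := isProbabilityMeasure_uniform hL
  have hm0 : (0 : ℝ) ≤ m := Nat.cast_nonneg m
  -- With `k = ⌈a⌉₊` the outer interval starts at or after `a + 1` and ends before `a + 2 + 4 * m ≤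
  -- b - 1`, so centres in it fit into `[0, L]`; hence the `3` in `hm`.
  set J : ℕ → ℕ → Set ℝ :=
    fun k i => Icc ((k + 1 : ℝ) + 2 * i) ((k + 1 : ℝ) + 4 * m - 2 * i) with hJ
  set K : Finset ℕ := (Finset.range ⌊L⌋₊).filter fun k : ℕ => (k + 1 : ℝ) + 4 * m ≤ L - 1 with hK
  have hsub : {x | ∀ a b, IsGap L x a b → b - a < g}ᶜ ⊆ ⋃ k ∈ K, AvoidsInner (J k) m 0 := by
    intro x hx
    simp only [mem_compl_iff, mem_ofPred_eq, not_forall, not_lt] at hx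
    obtain ⟨a, b, hgap, hab⟩ := hx
    have hle : a ≤ b := by linarith
    have ha : 0 ≤ a := (mem_freeSpace.1 (hgap.subset_freeSpace ⟨le_rfl, hle⟩)).1.1
    have hb : b ≤ L := (mem_freeSpace.1 (hgap.subset_freeSpace ⟨hle, le_rfl⟩)).1.2
    have hk1 : a ≤ ⌈a⌉₊ := Nat.le_ceil a
    have hk2 : (⌈a⌉₊ : ℝ) < a + 1 := Nat.ceil_lt_add_one ha
    refine mem_iUnion₂.2 ⟨⌈a⌉₊, ?_, ?_⟩
    · refine Finset.mem_filter.2 ⟨Finset.mem_range.2 (Nat.le_floor ?_), by linarith⟩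
      push_cast
      linarith
    · refine mem_avoidsInner_of_not_isPlaced (L := L) (by linarith) (by linarith)
        fun t ht => hgap.not_isPlaced ⟨by linarith [ht.1], by linarith [ht.2]⟩
  have hbound : ∀ k ∈ K, (candidateLaw L).real (AvoidsInner (J k) m 0) ≤
      1 / (m.factorial : ℝ) := by
    intro k hk
    have hkL := (Finset.mem_filter.1 hk).2
    have hk0 : (0 : ℝ) ≤ k := Nat.cast_nonneg k
    refine real_avoidsInner_zero_le (uniform L) (c := 4 / L) (fun i => measurableSet_Icc) ?_
      (by positivity) fun i hi => ?_
    · intro i j hij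
      have : (i : ℝ) ≤ j := Nat.cast_le.2 hij
      exact Icc_subset_Icc (by linarith) (by linarith)
    · have hi' : (i : ℝ) ≤ m := Nat.cast_le.2 hi
      have hi0 : (0 : ℝ) ≤ i := Nat.cast_nonneg i
      rw [uniform_real_Icc hL (by linarith) (by linarith) (by linarith)]
      ring
  calc (candidateLaw L).real {x | ∀ a b, IsGap L x a b → b - a < g}ᶜ
      ≤ (candidateLaw L).real (⋃ k ∈ K, AvoidsInner (J k) m 0) := by
        have := isProbabilityMeasure_candidateLaw hL
        exact measureReal_mono hsub (measure_ne_top _ _)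
    _ ≤ ∑ k ∈ K, (candidateLaw L).real (AvoidsInner (J k) m 0) := measureReal_biUnion_finset_le _ _
    _ ≤ ∑ _k ∈ K, 1 / (m.factorial : ℝ) := Finset.sum_le_sum hbound
    _ = K.card / (m.factorial : ℝ) := by simp [div_eq_mul_inv]
    _ ≤ L / (m.factorial : ℝ) := by
        gcongr
        refine le_trans (Nat.cast_le.2 ((Finset.card_filter_le _ _).trans_eq
          (Finset.card_range _))) (Nat.floor_le hL.le)

lemma withHighProbability_of_real_le {E : ℝ → Set (ℕ → ℝ)} {f : ℝ → ℝ}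
    (hf : Tendsto f atTop (𝓝 0)) (h : ∀ᶠ L in atTop, (candidateLaw L).real (E L)ᶜ ≤ f L) :
    WithHighProbability E := by
  have hf' : Tendsto (fun L => ENNReal.ofReal (f L)) atTop (𝓝 0) := by
    simpa using ENNReal.tendsto_ofReal hf
  refine tendsto_of_tendsto_of_tendsto_of_le_of_le' tendsto_const_nhds hf'
    (Eventually.of_forall fun _ => zero_le) ?_
  filter_upwards [h, eventually_gt_atTop 0] with L hL hL0
  have := isProbabilityMeasure_candidateLaw hL0
  exact ENNReal.le_ofReal_iff_toReal_le (measure_ne_top _ _)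
    (measureReal_nonneg.trans hL) |>.2 hL

theorem withHighProbability_gap_lt_log :
    WithHighProbability fun L => {x | ∀ a b, IsGap L x a b → b - a < Real.log L} := by
  set m : ℝ → ℕ := fun L => ⌊(Real.log L - 3) / 4⌋₊ with hm
  have hmt : Tendsto m atTop atTop := by
    refine tendsto_nat_floor_atTop.comp (Tendsto.atTop_div_const (by norm_num) ?_)
    exact tendsto_atTop_add_const_right _ _ Real.tendsto_log_atTop
  refine withHighProbability_of_real_le
    (f := fun L => Real.exp 7 * (Real.exp 4 ^ m L / ((m L).factorial : ℝ))) ?_ ?_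
  · simpa using ((FloorSemiring.tendsto_pow_div_factorial_atTop (Real.exp 4)).comp hmt).const_mul
      (Real.exp 7)
  · filter_upwards [eventually_gt_atTop 0, Real.tendsto_log_atTop.eventually_ge_atTop 3]
      with L hL hlog
    have h1 : (m L : ℝ) ≤ (Real.log L - 3) / 4 := Nat.floor_le (by linarith)
    have h2 : (Real.log L - 3) / 4 < m L + 1 := Nat.lt_floor_add_one _
    -- The floor gives `log L < 4 * m + 7`, that is, `L` is below `exp 7 * exp 4 ^ m`, which the
    -- factorial beats.
    refine (candidateLaw_real_exists_gap_le hL (m := m L) (by linarith)).trans ?_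
    rw [← mul_div_assoc]
    gcongr
    rw [← Real.exp_nat_mul, ← Real.exp_add, ← Real.log_le_iff_le_exp hL]
    linarith

/-! ### Existence of fairly large gaps -/

/-- The probability that there is no gap of size at least `m` between two placed rods. -/
lemma candidateLaw_real_no_gap_le {L : ℝ} (hL : 0 < L) (m : ℕ) :
    (candidateLaw L).real {x | ∃ a b, IsGapBetweenRods L x a b ∧ (m : ℝ) ≤ b - a}ᶜ ≤
      (1 - (1 / (2 * (m + 7 : ℝ))) ^ (m + 2)) ^ ⌊L / (m + 7)⌋₊ := by
  have := isProbabilityMeasure_uniform hL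
  have := isProbabilityMeasure_candidateLaw hL
  have hm0 : (0 : ℝ) ≤ m := Nat.cast_nonneg m
  set N := ⌊L / (m + 7)⌋₊ with hN
  set w : ℕ → ℝ := fun i => i * (m + 7) with hw
  set J : ℕ → Set ℝ := fun i => Ico (w i) (w i + m + 7) with hJ
  have hw0 : ∀ i, 0 ≤ w i := fun i => by positivity
  have hwL : ∀ i < N, w i + m + 7 ≤ L := fun i hi => by
    have h1 : ((i + 1 : ℕ) : ℝ) ≤ L / (m + 7) :=
      (Nat.cast_le.2 hi).trans (Nat.floor_le (by positivity))
    rw [le_div_iff₀ (by positivity)] at h1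
    push_cast at h1
    simp only [hw]
    linarith
  have hdisj : Pairwise (Function.onFun Disjoint J) := by
    have key : ∀ i j : ℕ, i < j → Disjoint (J i) (J j) := by
      intro i j hij
      refine Set.disjoint_left.2 fun y hi hj => ?_
      have h1 : (i + 1 : ℝ) ≤ j := by exact_mod_cast hij
      have h2 : (i + 1 : ℝ) * (m + 7) ≤ j * (m + 7) := by gcongr
      have h3 := hi.2
      have h4 := hj.1
      simp only [hw] at h3 h4
      linarith
    intro i j hij
    rcases lt_or_gt_of_ne hij with h | h
    exacts [key i j h, (key j i h).symm]
  have hsub : {x | ∃ a b, IsGapBetweenRods L x a b ∧ (m : ℝ) ≤ b - a}ᶜ ⊆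
      {x | ∀ i ∈ Finset.range N, ¬ HitsInOrder (J i) (cells (w i) m) x} := fun x hx i hi h =>
    hx (exists_isGapBetweenRods_of_hitsInOrder (hw0 i) (hwL i (Finset.mem_range.1 hi)) h)
  have hJμ : ∀ i < N, (uniform L).real (J i) = (m + 7) / L := fun i hi => by
    rw [hJ, uniform_real_Ico hL (hw0 i) (by linarith) (hwL i hi)]
    ring
  have hp : 1 / (2 * (m + 7 : ℝ)) * ((m + 7) / L) = 1 / 2 / L := by field_simp
  have hcells : ∀ i ∈ Finset.range N, ∀ c ∈ cells (w i) m, MeasurableSet c ∧ c ⊆ J i ∧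
      (uniform L).real c = 1 / (2 * (m + 7 : ℝ)) * (uniform L).real (J i) := by
    intro i hi c hc
    have hiN := Finset.mem_range.1 hi
    have hwi := hw0 i
    have hwiL := hwL i hiN
    rw [hJμ i hiN, hp]
    simp only [cells, List.mem_append, List.mem_map, List.mem_range, List.mem_singleton] at hc
    rcases hc with ⟨k, hk, rfl⟩ | rfl
    · have hk' : (k : ℝ) ≤ m := Nat.cast_le.2 (Nat.lt_succ_iff.1 hk)
      have hk0 : (0 : ℝ) ≤ k := Nat.cast_nonneg k
      refine ⟨measurableSet_Icc, Icc_subset_Ico (by linarith) (by linarith), ?_⟩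
      rw [uniform_real_Icc hL (by linarith) (by linarith) (by linarith)]
      ring
    · refine ⟨measurableSet_Icc, Icc_subset_Ico (by linarith) (by linarith), ?_⟩
      rw [uniform_real_Icc hL (by linarith) (by linarith) (by linarith)]
      ring
  have h := real_forall_not_hitsInOrder_le (uniform L) (fun i => measurableSet_Ico) hdisj
    (p := 1 / (2 * (m + 7 : ℝ))) (by positivity)
    ((div_le_one (by positivity)).2 (by linarith)) (Finset.range N) (fun i => cells (w i) m)
    (fun i hi => by rw [hJμ i (Finset.mem_range.1 hi)]; positivity) hcells
  refine (measureReal_mono hsub).trans (h.trans_eq ?_)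
  simp

/-- The hypothesis says `q ^ (m + 3) ≤ √L` for `q = 2 * (m + 7)`. At least `L / q` windows, each
succeeding with probability `q ^ (-(m + 2))`, give exponent at least `√L`. -/
lemma candidateLaw_real_no_gap_le_exp {L : ℝ} (hL : 0 < L) {m : ℕ}
    (hm : (m + 3) * Real.log (2 * (m + 7)) ≤ Real.log L / 2) :
    (candidateLaw L).real {x | ∃ a b, IsGapBetweenRods L x a b ∧ (m : ℝ) ≤ b - a}ᶜ ≤
      Real.exp (-Real.exp (Real.log L / 2)) := by
  have hm0 : (0 : ℝ) ≤ m := Nat.cast_nonneg m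
  refine (candidateLaw_real_no_gap_le hL m).trans ?_
  set q : ℝ := 2 * (m + 7) with hq
  set N := ⌊L / (m + 7)⌋₊ with hN
  have hq0 : 0 < q := by positivity
  have hlogq : 0 ≤ Real.log q := Real.log_nonneg (by linarith)
  have hqL : q ≤ L := by
    rw [← Real.log_le_log_iff hq0 hL]
    nlinarith
  -- The factor `2` in `q` pays for the rounding.
  have hNL : L / q ≤ N := by
    have h1 : L / (m + 7) < N + 1 := Nat.lt_floor_add_one _
    have h2 : L / (m + 7) = 2 * (L / q) := by rw [hq]; field_simp
    have h3 : 1 ≤ L / q := (one_le_div hq0).2 hqL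
    linarith
  have hpow : 0 ≤ 1 - (1 / q) ^ (m + 2) := by
    refine sub_nonneg.2 (pow_le_one₀ (by positivity) ((div_le_one hq0).2 (by linarith)))
  calc (1 - (1 / q) ^ (m + 2)) ^ N ≤ Real.exp (-(1 / q) ^ (m + 2)) ^ N :=
        pow_le_pow_left₀ hpow (Real.one_sub_le_exp_neg _) N
    _ = Real.exp (-(N * (1 / q) ^ (m + 2))) := by rw [← Real.exp_nat_mul]; ring_nf
    _ ≤ Real.exp (-Real.exp (Real.log L / 2)) := by
        refine Real.exp_le_exp.2 (neg_le_neg ?_)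
        calc Real.exp (Real.log L / 2)
            ≤ Real.exp (Real.log L - (m + 3) * Real.log q) := Real.exp_le_exp.2 (by linarith)
          _ = L / q * (1 / q) ^ (m + 2) := by
              have : ((m : ℝ) + 3) = ((m + 3 : ℕ) : ℝ) := by push_cast; ring
              rw [Real.exp_sub, Real.exp_log hL, this, Real.exp_nat_mul, Real.exp_log hq0]
              rw [one_div_pow, div_mul_div_comm, mul_one, ← pow_succ']
          _ ≤ N * (1 / q) ^ (m + 2) := by gcongr

/-- An exponent below `1` leaves room for the logarithm: `y ^ γ * log y = o(y)` for `γ < 1`. -/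
lemma eventually_mul_log_le {ε : ℝ} (hε : 0 < ε) :
    ∀ᶠ y : ℝ in atTop,
      ((⌈y ^ (1 - ε)⌉₊ : ℝ) + 3) * Real.log (2 * (⌈y ^ (1 - ε)⌉₊ + 7)) ≤ y / 2 := by
  -- The maximum keeps the exponent positive when `ε ≥ 1`. Below, the constant `36` makes each of
  -- two terms at most `y / 4`.
  set γ : ℝ := max (1 - ε) (1 / 2) with hγ
  have hγ1 : γ < 1 := max_lt (by linarith) (by norm_num)
  have hγ0 : 0 < γ := lt_of_lt_of_le (by norm_num) (le_max_right _ _)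
  have hlog := (isLittleO_log_rpow_atTop (sub_pos.2 hγ1)).bound
    (show (0 : ℝ) < 1 / 36 by norm_num)
  have hconst := (tendsto_rpow_atTop (sub_pos.2 hγ1)).eventually_ge_atTop (36 * Real.log 18)
  filter_upwards [hlog, hconst, eventually_ge_atTop 1] with y h1 h2 hy
  have hy0 : 0 < y := by linarith
  have hly : 0 ≤ Real.log y := Real.log_nonneg hy
  rw [Real.norm_of_nonneg hly, Real.norm_of_nonneg (by positivity)] at h1
  have hyγ : 1 ≤ y ^ γ := Real.one_le_rpow hy hγ0.le
  have hsplit : y ^ γ * y ^ (1 - γ) = y := by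
    rw [← Real.rpow_add hy0]; simp
  have hm : (⌈y ^ (1 - ε)⌉₊ : ℝ) ≤ y ^ γ + 1 := by
    have h3 : (⌈y ^ (1 - ε)⌉₊ : ℝ) < y ^ (1 - ε) + 1 := Nat.ceil_lt_add_one (by positivity)
    have h4 : y ^ (1 - ε) ≤ y ^ γ := Real.rpow_le_rpow_of_exponent_le hy (le_max_left _ _)
    linarith
  have hm0 : (0 : ℝ) ≤ ⌈y ^ (1 - ε)⌉₊ := Nat.cast_nonneg _
  calc ((⌈y ^ (1 - ε)⌉₊ : ℝ) + 3) * Real.log (2 * (⌈y ^ (1 - ε)⌉₊ + 7))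
      ≤ (9 * y ^ γ) * Real.log (18 * y ^ γ) := by
        have : 0 ≤ Real.log (2 * ((⌈y ^ (1 - ε)⌉₊ : ℝ) + 7)) := Real.log_nonneg (by linarith)
        have : Real.log (2 * ((⌈y ^ (1 - ε)⌉₊ : ℝ) + 7)) ≤ Real.log (18 * y ^ γ) :=
          Real.log_le_log (by positivity) (by linarith)
        gcongr
        linarith
    _ = 9 * y ^ γ * Real.log 18 + 9 * γ * (y ^ γ * Real.log y) := by
        rw [Real.log_mul (by norm_num) (by positivity), Real.log_rpow hy0]
        ring
    _ ≤ 9 * y ^ γ * (y ^ (1 - γ) / 36) + 9 * 1 * (y ^ γ * (1 / 36 * y ^ (1 - γ))) := by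
        gcongr
        linarith
    _ = y ^ γ * y ^ (1 - γ) / 2 := by ring
    _ = y / 2 := by rw [hsplit]

theorem withHighProbability_exists_gap {ε : ℝ} (hε : 0 < ε) :
    WithHighProbability fun L =>
      {x | ∃ a b, IsGapBetweenRods L x a b ∧ Real.log L ^ (1 - ε) ≤ b - a} := by
  refine withHighProbability_of_real_le (f := fun L => Real.exp (-Real.exp (Real.log L / 2))) ?_ ?_
  · exact Real.tendsto_exp_neg_atTop_nhds_zero.comp
      (Real.tendsto_exp_atTop.comp (Real.tendsto_log_atTop.atTop_div_const (by norm_num)))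
  · filter_upwards [eventually_gt_atTop 0,
      Real.tendsto_log_atTop.eventually (eventually_mul_log_le hε)] with L hL hm
    have := isProbabilityMeasure_candidateLaw hL
    refine (measureReal_mono (compl_subset_compl.2 ?_)).trans
      (candidateLaw_real_no_gap_le_exp hL hm)
    rintro x ⟨a, b, hgap, hab⟩
    exact ⟨a, b, hgap, (Nat.le_ceil _).trans hab⟩

end GhostHardCore

end

theorem theorem1p4 :
    GhostHardCore.WithHighProbability
      (fun L : ℝ => {x | ∀ a b : ℝ, GhostHardCore.IsGap L x a b → b - a < Real.log L}) ∧
    ∀ ε : ℝ, 0 < ε →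
      GhostHardCore.WithHighProbability
        (fun L : ℝ => {x | ∃ a b : ℝ, GhostHardCore.IsGapBetweenRods L x a b ∧
          Real.log L ^ (1 - ε) ≤ b - a}) :=
  ⟨GhostHardCore.withHighProbability_gap_lt_log,
    fun _ hε => GhostHardCore.withHighProbability_exists_gap hε⟩
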